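/- Let $m\ge 1$ and let $W$ be an oriented hyperbolic manifold of dimension $m+1$ with totally geodesic boundary $M=\partial W$, i.e. $W$ is locally modelled on a closed half-space of $\mathbb H^{m+1}$ bounded by a totally geodesic hyperplane, with changes of charts that are locally restrictions of elements of $G=\mathrm{Isom}(\mathbb H^{m+1})$. Let $\mathcal E$ be the flat bundle over $W$ with fibre the Lie algebra $\mathfrak g=\mathfrak{so}(1,m+1)$ of $G$, glued over changes of charts $g$ by $\mathrm{Ad}(g)$. For $v\in T_pW$ let $E_v\in\mathcal E_p$ be the infinitesimal translation at $p$ in the direction $v$. For an orthonormal frame $(e_j)$ write $E_j=E_{e_j}$ and $R_{ij}=[E_i,E_j]$; $\mathcal E_p$ carries the metric for which the $E_i$ and the $R_{ij}$ $(i<j)$ form an orthonormal basis. For an $\mathcal E$-valued form $\alpha$ put $T\alpha=\sum_j\omega_j\wedge[E_j,\alpha]$, where $(\omega_j)$ is the coframe dual to $(e_j)$. Let $\omega$ be a smooth $\mathcal E$-valued $1$-form on $W$. At a point $p\in M$ let $n$ be the outward unit normal, $dr$ its dual covector, $(e_1,\dots,e_m)$ an orthonormal basis of $T_pM$, $(\omega_1,\dots,\omega_m)$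 the dual tangential covectors, $N=E_n$, $E_i=E_{e_i}$, $R_{ab}=[E_a,E_b]$, $R_{ni}=[N,E_i]$. Then at $p$ the form $\omega$ can be written uniquely as $$\omega = F\,N\otimes dr+\sum_i E_{i1}\,E_i\otimes dr+\sum_{a<b}D_{ab}\,R_{ab}\otimes dr+\sum_i C_i\,R_{ni}\otimes dr$$ $$\qquad+\sum_j G_j\,N\otimes\omega_j+\sum_{i,j}A_{ij}\,E_i\otimes\omega_j+\sum_{a<b,\,j}H_{ab,j}\,R_{ab}\otimes\omega_j+\sum_{i,j}B_{ij}\,R_{ni}\otimes\omega_j ,$$ where $\mathbf A,\mathbf B$ are $m\times m$, $\mathbf C$ and $\mathbf E=(E_{i1})$ are $m\times1$, $\mathbf D$ is $\binom m2\times 1$, $\mathbf F$ is $1\times1$, $\mathbf G$ is $1\times m$ and $\mathbf H$ is $\binom m2\times m$. Let $\mathrm{skew}(\mathbf D)$ be the $m\times m$ matrix of the skew-symmetric transformation $\sum_{a<b}D_{ab}R_{ab}$, where $R_{ab}$ sends $e_b\mapsto e_a$, $e_a\mapsto -e_b$ and annihilates the other $e_i$. Let $\mathrm{rot}(\mathbf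 E)$ be the $\binom m2\times m$ matrix of coefficients, with respect to the $R_{ab}\otimes\omega_j$ $(a<b)$, of $\sum_{i,j}E_{i1}\,R_{ij}\otimes\omega_j$ (where $R_{ji}=-R_{ij}$, $R_{ii}=0$). Then the real-valued $m$-form $\omega\wedge{*}T\omega$ (coefficients in $\mathcal E$ being paired by the metric), restricted to $M$, equals at $p$ the volume form of $M$ (oriented by the outward normal) times $$\mathbf G\cdot\mathbf C^T+\mathbf A\cdot\mathbf B+\mathbf A\cdot\mathrm{skew}(\mathbf D)+\mathbf H\cdot\mathrm{rot}(\mathbf E)+\mathbf B\cdot\mathbf A+\mathbf B\cdot\mathbf F(\mathrm{Id}),$$ where $X\cdot Y=\sum_{i,j}X_{ij}Y_{ij}$ is the dot product of matrices of the same shape and $\mathbf F(\mathrm{Id})$ is the scalar matrix with diagonal entries $\mathbf F$. -/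

import Mathlib

open scoped Topology Matrix

noncomputable section

namespace Hyp

attribute [local instance] LieRing.ofAssociativeRing

/-! ### Hyperbolic space, its isometry group and its Lie algebra -/

/-- The ambient vector space of Minkowski space `ℝ^{1,m+1}`. -/
abbrev Mink (m : ℕ) : Type := Fin (m + 2) → ℝ

/-- The Gram matrix `diag(-1, 1, …, 1)` of the Lorentz form. -/
def J (m : ℕ) : Matrix (Fin (m + 2)) (Fin (m + 2)) ℝ :=
  Matrix.diagonal (fun i => if i = 0 then -1 else 1)

/-- The Lorentz form `-x₀y₀ + x₁y₁ + … + x_{m+1}y_{m+1}`. -/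
def lor {m : ℕ} (x y : Mink m) : ℝ := x ⬝ᵥ (J m *ᵥ y)

/-- The hyperboloid model of hyperbolic space of dimension `m + 1`. -/
def hyperboloid (m : ℕ) : Set (Mink m) := {x | lor x x = -1 ∧ 0 < x 0}

/-- The closed half-space `{x₁ ≥ 0}` of hyperbolic `(m+1)`-space. It is bounded by the totally
geodesic hyperplane `{x₁ = 0}`. -/
def HalfSpace (m : ℕ) : Type := {x : Mink m // x ∈ hyperboloid m ∧ 0 ≤ x 1}

instance (m : ℕ) : TopologicalSpace (HalfSpace m) :=
  inferInstanceAs (TopologicalSpace {x : Mink m // x ∈ hyperboloid m ∧ 0 ≤ x 1})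

/-- The point of Minkowski space underlying a point of the half-space. -/
def HalfSpace.pt {m : ℕ} (x : HalfSpace m) : Mink m := x.1

/-- `Isom(ℍ^{m+1})`: the linear maps that preserve the Lorentz form and the upper sheet of the
hyperboloid. -/
def IsIsom {m : ℕ} (g : GL (Fin (m + 2)) ℝ) : Prop :=
  (∀ x y : Mink m, lor (g.1 *ᵥ x) (g.1 *ᵥ y) = lor x y) ∧
    ∀ x ∈ hyperboloid m, g.1 *ᵥ x ∈ hyperboloid m

/-- The Lie algebra `𝔤 = 𝔰𝔬(1, m+1)` of `Isom(ℍ^{m+1})`. -/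
abbrev so1 (m : ℕ) : LieSubalgebra ℝ (Matrix (Fin (m + 2)) (Fin (m + 2)) ℝ) :=
  skewAdjointMatricesLieSubalgebra (J m)

/-! ### Elementary facts on the Lorentz form -/

lemma lor_eq {m : ℕ} (x y : Mink m) :
    lor x y = -(x 0 * y 0) + ∑ i : Fin (m + 1), x i.succ * y i.succ := by
  simp [lor, J, dotProduct, Matrix.mulVec_diagonal, Fin.sum_univ_succ, Fin.succ_ne_zero]

lemma lor_comm {m : ℕ} (x y : Mink m) : lor x y = lor y x := by
  simp [lor_eq, mul_comm]

lemma lor_add {m : ℕ} (x y z : Mink m) : lor x (y + z) = lor x y + lor x z := by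
  simp [lor, Matrix.mulVec_add]

lemma lor_smul {m : ℕ} (c : ℝ) (x y : Mink m) : lor x (c • y) = c * lor x y := by
  simp [lor, Matrix.mulVec_smul]

lemma lor_single_one {m : ℕ} (x : Mink m) : lor x (Pi.single 1 1) = x 1 := by
  simp [lor, J, dotProduct, Matrix.mulVec_diagonal, Pi.single_apply]

lemma mul_sq_le_of_tangent {m : ℕ} {x v : Mink m} (hx : x ∈ hyperboloid m) (h : lor x v = 0) :
    v 0 ^ 2 ≤ x 0 ^ 2 * lor v v ∧ 0 ≤ lor v v := by
  obtain ⟨h1, h0⟩ := hx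
  rw [lor_eq] at h1 h
  have cs := Finset.sum_mul_sq_le_sq_mul_sq Finset.univ
    (fun i : Fin (m + 1) => x i.succ) (fun i => v i.succ)
  have hv : lor v v = -(v 0 * v 0) + ∑ i : Fin (m + 1), v i.succ ^ 2 := by
    rw [lor_eq]; simp [sq]
  have hx2 : ∑ i : Fin (m + 1), x i.succ ^ 2 = x 0 ^ 2 - 1 := by
    have : ∑ i : Fin (m + 1), x i.succ * x i.succ = ∑ i : Fin (m + 1), x i.succ ^ 2 := by
      simp [sq]
    rw [this] at h1; linarith [sq (x 0)]
  have hxv : ∑ i : Fin (m + 1), x i.succ * v i.succ = x 0 * v 0 := by linarith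
  simp only [hx2, hxv] at cs
  set S := ∑ i : Fin (m + 1), v i.succ ^ 2 with hS
  have hS0 : 0 ≤ S := Finset.sum_nonneg fun i _ => sq_nonneg _
  have key : v 0 ^ 2 ≤ x 0 ^ 2 * lor v v := by
    have : (x 0 * v 0) ^ 2 ≤ (x 0 ^ 2 - 1) * S := cs
    rw [hv]
    have hSv : v 0 ^ 2 ≤ S := by
      by_contra hlt
      push Not at hlt
      have hp : 0 < x 0 ^ 2 := by positivity
      nlinarith
    nlinarith
  refine ⟨key, ?_⟩
  have hp : 0 < x 0 ^ 2 := by positivity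
  by_contra hlt
  push Not at hlt
  nlinarith [sq_nonneg (v 0)]

/-! ### Tangent spaces -/

/-- `T_xℍ = {v | ⟨x, v⟩ = 0}`. -/
def tangentSubmodule {m : ℕ} (x : HalfSpace m) : Submodule ℝ (Mink m) where
  carrier := {v | lor x.pt v = 0}
  zero_mem' := by simp [lor]
  add_mem' {a b} ha hb := by
    simp only [Set.mem_ofPred_eq] at *
    rw [lor_add, ha, hb, add_zero]
  smul_mem' c a ha := by
    simp only [Set.mem_ofPred_eq] at *
    rw [lor_smul, ha, mul_zero]

/-- The tangent space of hyperbolic space at the point `x` of the half-space. It carries the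
hyperbolic metric, see below, and not the metric of `ℝ^{m+2}`. -/
def HTangent {m : ℕ} (x : HalfSpace m) : Type := ↥(tangentSubmodule x)

instance {m : ℕ} (x : HalfSpace m) : AddCommGroup (HTangent x) :=
  inferInstanceAs (AddCommGroup ↥(tangentSubmodule x))

instance {m : ℕ} (x : HalfSpace m) : Module ℝ (HTangent x) :=
  inferInstanceAs (Module ℝ ↥(tangentSubmodule x))

/-- The inclusion of the tangent space in Minkowski space. -/
def HTangent.vec {m : ℕ} {x : HalfSpace m} : HTangent x →ₗ[ℝ] Mink m :=
  (tangentSubmodule x).subtype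

lemma HTangent.lor_vec {m : ℕ} {x : HalfSpace m} (v : HTangent x) :
    lor x.pt v.vec = 0 := v.2

lemma HTangent.vec_injective {m : ℕ} {x : HalfSpace m} :
    Function.Injective (HTangent.vec : HTangent x → Mink m) := Subtype.val_injective

/-- The hyperbolic metric: the restriction of the Lorentz form to the tangent space. -/
@[reducible] def tangentCore {m : ℕ} (x : HalfSpace m) : InnerProductSpace.Core ℝ (HTangent x) where
  inner v w := lor v.vec w.vec
  conj_inner_symm v w := by simp [lor_comm]
  re_inner_nonneg v := (mul_sq_le_of_tangent x.2.1 v.lor_vec).2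
  add_left u v w := by
    rw [map_add, lor_comm, lor_add, lor_comm u.vec, lor_comm v.vec]
  smul_left v w c := by
    rw [map_smul, lor_comm, lor_smul, lor_comm v.vec]; rfl
  definite v h := by
    have h' : lor v.vec v.vec = 0 := h
    have h0 := (mul_sq_le_of_tangent x.2.1 v.lor_vec).1
    rw [h', mul_zero] at h0
    have hv0 : v.vec 0 = 0 := by nlinarith [sq_nonneg (v.vec 0)]
    rw [lor_eq, hv0] at h'
    simp only [mul_zero, neg_zero, zero_add] at h'
    rw [Finset.sum_eq_zero_iff_of_nonneg (fun i _ => mul_self_nonneg _)] at h'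
    apply HTangent.vec_injective
    rw [map_zero]
    funext i
    refine Fin.cases hv0 (fun j => ?_) i
    exact mul_self_eq_zero.mp (h' j (Finset.mem_univ j))

instance {m : ℕ} (x : HalfSpace m) : NormedAddCommGroup (HTangent x) :=
  (tangentCore x).toNormedAddCommGroup

instance {m : ℕ} (x : HalfSpace m) : InnerProductSpace ℝ (HTangent x) :=
  InnerProductSpace.ofCore (tangentCore x).toCore

lemma inner_eq_lor {m : ℕ} {x : HalfSpace m} (v w : HTangent x) :
    inner ℝ v w = lor v.vec w.vec := rfl

instance {m : ℕ} (x : HalfSpace m) : FiniteDimensional ℝ (HTangent x) :=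
  inferInstanceAs (FiniteDimensional ℝ ↥(tangentSubmodule x))

instance finrank_tangent {m : ℕ} (x : HalfSpace m) :
    Fact (Module.finrank ℝ (HTangent x) = m + 1) := by
  constructor
  let f : Module.Dual ℝ (Mink m) :=
    { toFun := lor x.pt, map_add' := lor_add _, map_smul' := fun c v => lor_smul c _ v }
  have hf : f ≠ 0 := by
    intro h
    have : f x.pt = 0 := by rw [h]; rfl
    have h1 : lor x.pt x.pt = -1 := x.2.1.1
    have h2 : f x.pt = lor x.pt x.pt := rfl
    linarith
  have h1 := Module.Dual.finrank_ker_add_one_of_ne_zero hf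
  have h2 : LinearMap.ker f = tangentSubmodule x := rfl
  rw [h2] at h1
  have h3 : Module.finrank ℝ (HTangent x) = Module.finrank ℝ ↥(tangentSubmodule x) := rfl
  simp at h1
  omega

/-! ### Infinitesimal translations and rotations, the metric on `𝔤` at a point -/

/-- The matrix of `y ↦ x⟨v, y⟩ - v⟨x, y⟩`. -/
def translMatrix {m : ℕ} (x v : Mink m) : Matrix (Fin (m + 2)) (Fin (m + 2)) ℝ :=
  Matrix.vecMulVec x (J m *ᵥ v) - Matrix.vecMulVec v (J m *ᵥ x)

lemma J_transpose (m : ℕ) : (J m)ᵀ = J m := by simp [J]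

lemma translMatrix_mem {m : ℕ} (x v : Mink m) : translMatrix x v ∈ so1 m := by
  rw [mem_skewAdjointMatricesLieSubalgebra, mem_skewAdjointMatricesSubmodule]
  simp only [Matrix.IsSkewAdjoint, Matrix.IsAdjointPair, translMatrix]
  rw [Matrix.transpose_sub, Matrix.transpose_vecMulVec, Matrix.transpose_vecMulVec, sub_mul,
    Matrix.vecMulVec_mul, Matrix.vecMulVec_mul, mul_neg, mul_sub, Matrix.mul_vecMulVec,
    Matrix.mul_vecMulVec, neg_sub, ← Matrix.mulVec_transpose, ← Matrix.mulVec_transpose,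
    J_transpose]

/-- The infinitesimal translation at `x` in the direction `v`. For a unit vector `v` it is the
generator of the one-parameter group of translations along the geodesic through `x` with
velocity `v` (see `transl_boost` and `transl_conj`). -/
def transl {m : ℕ} (x : HalfSpace m) : HTangent x →ₗ[ℝ] so1 m where
  toFun v := ⟨translMatrix x.pt v.vec, translMatrix_mem _ _⟩
  map_add' v w := by
    ext i j
    simp [translMatrix, Matrix.mulVec_add, Matrix.vecMulVec_apply]
    ring
  map_smul' c v := by
    ext i j
    simp [translMatrix, Matrix.mulVec_smul, Matrix.vecMulVec_apply]
    ring

/-- At the base point `(1,0,…,0)`, the infinitesimal translation in the direction of the first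
coordinate axis is `E₀₁ + E₁₀`, the derivative at `t = 0` of the boosts with block
`(cosh t, sinh t; sinh t, cosh t)`. -/
lemma transl_boost (m : ℕ) :
    translMatrix (m := m) (Pi.single 0 1) (Pi.single 1 1) =
      Matrix.single 0 1 1 + Matrix.single 1 0 1 := by
  ext i j
  simp only [translMatrix, J, Matrix.sub_apply, Matrix.vecMulVec_apply, Matrix.mulVec_diagonal,
    Pi.single_apply, Matrix.add_apply, Matrix.single_apply]
  by_cases h0 : i = 0 <;> by_cases h1 : i = 1 <;> by_cases h2 : j = 0 <;> by_cases h3 : j = 1 <;>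
    simp_all [eq_comm]

/-- Infinitesimal translations are natural: `Ad(g)` takes the one at `x` in the direction `v` to
the one at `gx` in the direction `gv`. -/
lemma transl_conj {m : ℕ} {g : GL (Fin (m + 2)) ℝ} (hg : IsIsom g) (x v : Mink m) :
    g.1 * translMatrix x v * g⁻¹.1 = translMatrix (g.1 *ᵥ x) (g.1 *ᵥ v) := by
  have hJ : g.1ᵀ * J m * g.1 = J m := by
    refine Matrix.ext_of_mulVec_single fun j => ?_
    funext i
    have h1 := hg.1 (Pi.single i 1) (Pi.single j 1)
    have h2 : ∀ a b : Mink m, (g.1 *ᵥ a) ⬝ᵥ b = a ⬝ᵥ (g.1ᵀ *ᵥ b) := by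
      intro a b
      rw [Matrix.dotProduct_mulVec, Matrix.vecMul_transpose]
    simp only [lor] at h1
    rw [h2, Matrix.mulVec_mulVec, Matrix.mulVec_mulVec] at h1
    simpa only [single_one_dotProduct, Matrix.mul_assoc] using h1
  have hinv : ∀ w : Mink m, (J m *ᵥ w) ᵥ* g⁻¹.1 = J m *ᵥ (g.1 *ᵥ w) := by
    intro w
    have h1 : J m * g.1 = (g⁻¹.1)ᵀ * J m := by
      have h2 : (g⁻¹.1)ᵀ * g.1ᵀ = 1 := by
        rw [← Matrix.transpose_mul, ← Units.val_mul]; simp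
      calc J m * g.1 = ((g⁻¹.1)ᵀ * g.1ᵀ) * (J m * g.1) := by rw [h2, one_mul]
        _ = (g⁻¹.1)ᵀ * (g.1ᵀ * J m * g.1) := by simp only [Matrix.mul_assoc]
        _ = _ := by rw [hJ]
    rw [Matrix.mulVec_mulVec, h1, ← Matrix.mulVec_mulVec, Matrix.mulVec_transpose]
  rw [translMatrix, mul_sub, sub_mul, Matrix.mul_vecMulVec, Matrix.mul_vecMulVec,
    Matrix.vecMulVec_mul, Matrix.vecMulVec_mul, hinv, hinv, translMatrix]

/-- The Lorentz isometry that fixes `x` and is `-1` on `T_xℍ` (the point reflection at `x`). -/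
def pointReflection {m : ℕ} (x : HalfSpace m) : Matrix (Fin (m + 2)) (Fin (m + 2)) ℝ :=
  -1 - (2 : ℝ) • Matrix.vecMulVec x.pt (J m *ᵥ x.pt)

/-- The metric on `𝔤` at `x`, `⟨A, B⟩ = -½ tr(A σ B σ)` with `σ` the point reflection at `x`. It is
the metric for which, for an orthonormal basis `e_i` of `T_xℍ`, the infinitesimal translations
`E_i` and the infinitesimal rotations `R_ij = [E_i, E_j]`, `i < j`, are an orthonormal basis
(see `fiberMetric_transl`, `fiberMetric_transl_rot` and `fiberMetric_rot`). -/
def fiberMetric {m : ℕ} (x : HalfSpace m) : so1 m →ₗ[ℝ] so1 m →ₗ[ℝ] ℝ :=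
  LinearMap.mk₂ ℝ
    (fun A B : so1 m =>
      -(1 / 2 : ℝ) * (A.1 * pointReflection x * B.1 * pointReflection x).trace)
    (fun A A' B => by simp [add_mul]; ring)
    (fun c A B => by simp; ring)
    (fun A B B' => by simp [add_mul, mul_add])
    (fun c A B => by simp; ring)

lemma translMatrix_mul {m : ℕ} (x v y w : Mink m) :
    translMatrix x v * translMatrix y w =
      lor v y • Matrix.vecMulVec x (J m *ᵥ w) - lor v w • Matrix.vecMulVec x (J m *ᵥ y)
      - lor x y • Matrix.vecMulVec v (J m *ᵥ w) + lor x w • Matrix.vecMulVec v (J m *ᵥ y) := by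
  have h : ∀ a b c d : Mink m, Matrix.vecMulVec a (J m *ᵥ b) * Matrix.vecMulVec c (J m *ᵥ d) =
      lor b c • Matrix.vecMulVec a (J m *ᵥ d) := by
    intro a b c d
    rw [Matrix.vecMulVec_mul_vecMulVec, lor_comm b c, lor, dotProduct_comm]
    ext i j
    simp [Matrix.vecMulVec_apply]
    ring
  simp only [translMatrix, sub_mul, mul_sub, h]
  abel

lemma trace_vecMulVec_J {m : ℕ} (x v : Mink m) :
    (Matrix.vecMulVec x (J m *ᵥ v)).trace = lor x v := by
  rw [Matrix.trace_vecMulVec, lor]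

lemma pointReflection_conj {m : ℕ} (x : HalfSpace m) (a b : Mink m) :
    pointReflection x * translMatrix a b * pointReflection x =
      translMatrix (-a - (2 * lor x.pt a) • x.pt) (-b - (2 * lor x.pt b) • x.pt) := by
  have h1 : ∀ a b : Mink m, pointReflection x * Matrix.vecMulVec a b =
      Matrix.vecMulVec (-a - (2 * lor x.pt a) • x.pt) b := by
    intro a b
    rw [Matrix.mul_vecMulVec]
    congr 1
    funext i
    rw [lor_comm x.pt a]
    simp [pointReflection, Matrix.sub_mulVec, Matrix.neg_mulVec, Matrix.smul_mulVec,
      Matrix.vecMulVec_mulVec, lor, dotProduct_comm a]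
    ring
  have h2 : ∀ a b : Mink m, Matrix.vecMulVec a (J m *ᵥ b) * pointReflection x =
      Matrix.vecMulVec a (J m *ᵥ (-b - (2 * lor x.pt b) • x.pt)) := by
    intro a b
    rw [Matrix.vecMulVec_mul]
    congr 1
    funext i
    simp [pointReflection, Matrix.vecMul_sub, Matrix.vecMul_neg, Matrix.vecMul_smul,
      Matrix.vecMul_vecMulVec, Matrix.mulVec_sub, Matrix.mulVec_neg, Matrix.mulVec_smul, lor,
      dotProduct_comm]
    ring
  simp only [translMatrix, mul_sub, sub_mul, h1, h2]

/-- The infinitesimal rotations at `x`: `R(u,v) = [E_u, E_v]`. -/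
def rotation {m : ℕ} (x : HalfSpace m) (u v : HTangent x) : so1 m := ⁅transl x u, transl x v⁆

lemma rotation_val {m : ℕ} (x : HalfSpace m) (u v : HTangent x) :
    (rotation x u v).1 = translMatrix u.vec v.vec := by
  have h : (rotation x u v).1 = translMatrix x.pt u.vec * translMatrix x.pt v.vec
      - translMatrix x.pt v.vec * translMatrix x.pt u.vec := rfl
  have hx : lor x.pt x.pt = -1 := x.2.1.1
  rw [h, translMatrix_mul, translMatrix_mul, u.lor_vec, v.lor_vec, hx, lor_comm u.vec x.pt,
    lor_comm v.vec x.pt, u.lor_vec, v.lor_vec, lor_comm v.vec u.vec, translMatrix]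
  module

lemma fiberMetric_eq {m : ℕ} (x : HalfSpace m) (A B : so1 m) :
    fiberMetric x A B =
      -(1 / 2 : ℝ) * (A.1 * (pointReflection x * B.1 * pointReflection x)).trace := by
  simp only [fiberMetric, LinearMap.mk₂_apply, Matrix.mul_assoc]

lemma lor_neg {m : ℕ} (x y : Mink m) : lor x (-y) = -lor x y := by
  simp [lor, Matrix.mulVec_neg]

lemma lor_pt {m : ℕ} (x : HalfSpace m) : lor x.pt x.pt = -1 := x.2.1.1

lemma reflect_pt {m : ℕ} (x : HalfSpace m) : -x.pt - (2 * lor x.pt x.pt) • x.pt = x.pt := by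
  rw [lor_pt]; module

lemma reflect_vec {m : ℕ} (x : HalfSpace m) (v : HTangent x) :
    -v.vec - (2 * lor x.pt v.vec) • x.pt = -v.vec := by
  rw [v.lor_vec]; module

lemma fiberMetric_transl {m : ℕ} (x : HalfSpace m) (u v : HTangent x) :
    fiberMetric x (transl x u) (transl x v) = inner ℝ u v := by
  have h : ∀ w : HTangent x, (transl x w).1 = translMatrix x.pt w.vec := fun _ => rfl
  rw [fiberMetric_eq, h, h, pointReflection_conj, reflect_pt, reflect_vec, translMatrix_mul]
  simp only [Matrix.trace_add, Matrix.trace_sub, Matrix.trace_smul, trace_vecMulVec_J, lor_neg,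
    lor_pt, HTangent.lor_vec, lor_comm u.vec x.pt, inner_eq_lor, smul_eq_mul]
  ring

lemma fiberMetric_transl_rot {m : ℕ} (x : HalfSpace m) (u v w : HTangent x) :
    fiberMetric x (transl x u) (rotation x v w) = 0 := by
  have h : ∀ w : HTangent x, (transl x w).1 = translMatrix x.pt w.vec := fun _ => rfl
  rw [fiberMetric_eq, h, rotation_val, pointReflection_conj, reflect_vec, reflect_vec,
    translMatrix_mul]
  simp only [Matrix.trace_add, Matrix.trace_sub, Matrix.trace_smul, trace_vecMulVec_J, lor_neg,
    HTangent.lor_vec, smul_eq_mul]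
  ring

lemma fiberMetric_rot {m : ℕ} (x : HalfSpace m) (u v w z : HTangent x) :
    fiberMetric x (rotation x u v) (rotation x w z) =
      inner ℝ u w * inner ℝ v z - inner ℝ u z * inner ℝ v w := by
  rw [fiberMetric_eq, rotation_val, rotation_val, pointReflection_conj, reflect_vec, reflect_vec,
    translMatrix_mul]
  simp only [Matrix.trace_add, Matrix.trace_sub, Matrix.trace_smul, trace_vecMulVec_J, lor_neg,
    inner_eq_lor, smul_eq_mul]
  ring

/-! ### Exterior algebra on an oriented Euclidean space -/

/-- The wedge product of two vector-valued alternating forms, the coefficients being multiplied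
with the bilinear map `B` (with `(α ∧ β)(u, v) = B(α u, β v) - B(α v, β u)` in degrees 1, 1). -/
def wedge {V N₁ N₂ N : Type*} [AddCommGroup V] [Module ℝ V] [AddCommGroup N₁] [Module ℝ N₁]
    [AddCommGroup N₂] [Module ℝ N₂] [AddCommGroup N] [Module ℝ N]
    (B : N₁ →ₗ[ℝ] N₂ →ₗ[ℝ] N) {a b c : ℕ} (h : a + b = c)
    (α : V [⋀^Fin a]→ₗ[ℝ] N₁) (β : V [⋀^Fin b]→ₗ[ℝ] N₂) : V [⋀^Fin c]→ₗ[ℝ] N :=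
  ((TensorProduct.lift B).compAlternatingMap (α.domCoprod β)).domDomCongr
    (finSumFinEquiv.trans (finCongr h))

/-- The form `w ↦ ν(u₁, …, u_k, w₁, …, w_l)`. -/
def contract {V : Type*} [AddCommGroup V] [Module ℝ V] {n k l : ℕ} (h : k + l = n)
    (ν : V [⋀^Fin n]→ₗ[ℝ] ℝ) (u : Fin k → V) : V [⋀^Fin l]→ₗ[ℝ] ℝ where
  toFun w := ν.domDomCongr (finSumFinEquiv.trans (finCongr h)).symm (Sum.elim u w)
  map_update_add' w i x y := by
    classical
    rw [← Sum.update_elim_inr, ← Sum.update_elim_inr, ← Sum.update_elim_inr]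
    convert AlternatingMap.map_update_add _ _ _ _ _
  map_update_smul' w i c x := by
    classical
    rw [← Sum.update_elim_inr, ← Sum.update_elim_inr]
    convert AlternatingMap.map_update_smul _ _ _ _ _
  map_eq_zero_of_eq' w i j hw hij :=
    AlternatingMap.map_eq_zero_of_eq _ _ (i := Sum.inr i) (j := Sum.inr j) (by simpa using hw)
      (by simpa using hij)

/-- The Hodge star of an `F`-valued `k`-form on an oriented Euclidean space of dimension
`n = k + l`:
`(⋆β)(w) = (1/k!) ∑ β(b_{i₁}, …, b_{i_k}) vol(b_{i₁}, …, b_{i_k}, w₁, …, w_l)`, where the sum is over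
all `i : Fin k → Fin n` and `b` is an orthonormal basis, on the choice of which the result does not
depend. It sends `θ¹ ∧ … ∧ θᵏ` to `θᵏ⁺¹ ∧ … ∧ θⁿ` if `θ` is a positive orthonormal coframe, so that
`α ∧ ⋆β = ⟨α, β⟩ vol`. -/
def hodgeStar {V F : Type*} [NormedAddCommGroup V] [InnerProductSpace ℝ V]
    [FiniteDimensional ℝ V] [AddCommGroup F] [Module ℝ F] {n k l : ℕ}
    [Fact (Module.finrank ℝ V = n)] (o : Orientation ℝ V (Fin n)) (h : k + l = n)
    (β : V [⋀^Fin k]→ₗ[ℝ] F) : V [⋀^Fin l]→ₗ[ℝ] F :=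
  ((Nat.factorial k : ℝ)⁻¹) •
    ∑ i : Fin k → Fin (Module.finrank ℝ V),
      (LinearMap.toSpanSingleton ℝ F (β fun s => stdOrthonormalBasis ℝ V (i s))).compAlternatingMap
        (contract h o.volumeForm fun s => stdOrthonormalBasis ℝ V (i s))

/-- The operator `T = ∑ⱼ ωⱼ ∧ ad(Eⱼ)` on `𝔤`-valued `k`-forms at `x`, where `ωⱼ` is the coframe dual
to an orthonormal frame `eⱼ` (on the choice of which the result does not depend) and `Eⱼ` is the
infinitesimal translation at `x` in the direction `eⱼ`. -/
def opT {m k : ℕ} (x : HalfSpace m) (α : HTangent x [⋀^Fin k]→ₗ[ℝ] so1 m) :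
    HTangent x [⋀^Fin (1 + k)]→ₗ[ℝ] so1 m :=
  ∑ j, wedge (LinearMap.lsmul ℝ (so1 m)) rfl
    (AlternatingMap.ofSubsingleton ℝ (HTangent x) ℝ (0 : Fin 1)
      (innerₗ (HTangent x) (stdOrthonormalBasis ℝ (HTangent x) j)))
    ((LieAlgebra.ad ℝ (so1 m) (transl x (stdOrthonormalBasis ℝ (HTangent x) j)) :
      so1 m →ₗ[ℝ] so1 m).compAlternatingMap α)

/-! ### Hyperbolic manifolds with totally geodesic boundary -/

section Manifold

variable (m : ℕ) {W : Type*} [TopologicalSpace W] [ChartedSpace (HalfSpace m) W]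

/-- Near the point `q` the change of charts from `e` to `e'` is the restriction of `g`. -/
def IsTransition {m : ℕ} {W : Type*} [TopologicalSpace W]
    (e e' : OpenPartialHomeomorph W (HalfSpace m)) (q : W) (g : GL (Fin (m + 2)) ℝ) : Prop :=
  IsIsom g ∧ ∀ᶠ r in 𝓝 q, (e' r).pt = g.1 *ᵥ (e r).pt

/-- A hyperbolic `(m+1)`-manifold with totally geodesic boundary: a manifold with an atlas of charts
to the closed half-space `{x₁ ≥ 0}` of hyperbolic space, bounded by a totally geodesic hyperplane,
whose changes of charts are locally restrictions of isometries of hyperbolic space. -/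
class IsHyperbolicManifold (W : Type*) [TopologicalSpace W] [ChartedSpace (HalfSpace m) W] :
    Prop where
  transition : ∀ e ∈ atlas (HalfSpace m) W, ∀ e' ∈ atlas (HalfSpace m) W,
    ∀ q ∈ e.source ∩ e'.source, ∃ g : GL (Fin (m + 2)) ℝ, IsTransition e e' q g

/-- The image of `p` in the half-space under the preferred chart at `p`. -/
def base (p : W) : HalfSpace m := chartAt (HalfSpace m) p p

/-- The tangent space of `W` at `p`, read (as always in Mathlib) in the preferred chart at `p`. It
carries the hyperbolic metric. -/
abbrev TangentAt (p : W) : Type := HTangent (base m p)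

/-- The fibre at `p` of the flat bundle `E` over `W`, read in the preferred chart at `p`. It is a copy
of the Lie algebra `𝔤`. If `g` is the change of charts near `q` from `e` to `e'`, then the flat
trivializations of `E` over `e` and `e'` are related at `q` by `Ad(g)`; see `EForm.smooth`. -/
abbrev EFiber (_p : W) : Type := so1 m

/-- Smooth `E`-valued 1-forms on `W`. Smoothness near `p` is as follows: in the preferred chart at
`p`, where tangent vectors transform by the change of charts `g` and elements of `E` by `Ad(g)`, the
form is locally the restriction of a smooth map from an open subset of Minkowski space to the
matrix-valued linear forms (so it is smooth up to the boundary). -/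
structure EForm (W : Type*) [TopologicalSpace W] [ChartedSpace (HalfSpace m) W] where
  toForm : ∀ p : W, TangentAt m p [⋀^Fin 1]→ₗ[ℝ] EFiber m p
  smooth : ∀ p : W, ∃ (U : Set (Mink m))
    (Ω : Mink m → Mink m →ₗ[ℝ] Matrix (Fin (m + 2)) (Fin (m + 2)) ℝ),
      IsOpen U ∧ (base m p).pt ∈ U ∧
      (∀ v i j, ContDiffOn ℝ ((⊤ : ℕ∞) : WithTop ℕ∞) (fun y => Ω y v i j) U) ∧
      ∀ᶠ q in 𝓝 p, ∀ g : GL (Fin (m + 2)) ℝ,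
        IsTransition (chartAt (HalfSpace m) q) (chartAt (HalfSpace m) p) q g →
        ∀ v : TangentAt m q,
          Ω (chartAt (HalfSpace m) p q).pt (g.1 *ᵥ v.vec) =
            g.1 * (toForm q fun _ => v).1 * g⁻¹.1

/-- The determinant of the matrix with rows `x, v₀, …, v_m`. -/
def frameDet {m : ℕ} (x : Mink m) (v : Fin (m + 1) → Mink m) : ℝ :=
  (Matrix.of (Fin.cons x v : Fin (m + 2) → Mink m)).det

/-- An orientation of `W`: a choice of orientations of all tangent spaces which is locally constant
when read in charts. -/
structure ManifoldOrientation (W : Type*) [TopologicalSpace W] [ChartedSpace (HalfSpace m) W] where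
  orient : ∀ p : W, Orientation ℝ (TangentAt m p) (Fin (m + 1))
  locally_constant : ∀ p : W, ∀ᶠ q in 𝓝 p, ∀ g : GL (Fin (m + 2)) ℝ,
    IsTransition (chartAt (HalfSpace m) q) (chartAt (HalfSpace m) p) q g →
    ∀ (b : Module.Basis (Fin (m + 1)) ℝ (TangentAt m q))
      (c : Module.Basis (Fin (m + 1)) ℝ (TangentAt m p)),
      b.orientation = orient q → c.orientation = orient p →
      0 < frameDet (base m p).pt (fun i => (c i).vec) *
        frameDet (chartAt (HalfSpace m) p q).pt (fun i => g.1 *ᵥ (b i).vec)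

/-- The boundary `M = ∂W`. -/
def bdry (W : Type*) [TopologicalSpace W] [ChartedSpace (HalfSpace m) W] : Set W :=
  {p | (base m p).pt 1 = 0}

/-- The tangent space of `M` at `p`, as a subspace of the tangent space of `W`. -/
def bdryTangent (p : W) : Submodule ℝ (TangentAt m p) :=
  LinearMap.ker ((LinearMap.proj 1 : Mink m →ₗ[ℝ] ℝ) ∘ₗ HTangent.vec)

/-- The outward unit normal `n` at a boundary point. -/
def outwardNormal (p : W) (hp : p ∈ bdry m W) : TangentAt m p :=
  ⟨-Pi.single 1 1, by
    change lor (base m p).pt (-Pi.single 1 1) = 0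
    rw [lor_neg, lor_single_one]
    exact neg_eq_zero.mpr hp⟩

variable {m}

/-- The volume form of `M` at `p`, for the orientation of `M` as boundary of `W` given by the outward
normal: `vol_M(w₁, …, w_m) = vol_W(n, w₁, …, w_m)`. -/
def volM (o : ManifoldOrientation m W) (p : W) (hp : p ∈ bdry m W) :
    bdryTangent m p [⋀^Fin m]→ₗ[ℝ] ℝ :=
  ((o.orient p).volumeForm.curryLeft (outwardNormal m p hp)).compLinearMap
    (bdryTangent m p).subtype

/-- The real-valued `m`-form `ω ∧ ⋆Tω` on `W`, at `p`: the coefficients in `E` are paired with the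
metric of `E`. -/
def wedgeStarT (hm : 1 ≤ m) (o : ManifoldOrientation m W) (ω : EForm m W) (p : W) :
    TangentAt m p [⋀^Fin m]→ₗ[ℝ] ℝ :=
  wedge (fiberMetric (base m p)) (show 1 + (m - 1) = m by omega) (ω.toForm p)
    (hodgeStar (l := m - 1) (o.orient p) (by omega) (opT (base m p) (ω.toForm p)))

/-- The restriction (pull-back) of an `m`-form on `W` to `M`, at `p`. -/
def restrictM {k : ℕ} {p : W} (α : TangentAt m p [⋀^Fin k]→ₗ[ℝ] ℝ) :
    bdryTangent m p [⋀^Fin k]→ₗ[ℝ] ℝ :=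
  α.compLinearMap (bdryTangent m p).subtype

/-! ### The blocks of an `E`-valued 1-form at a boundary point -/

/-- The pairs `a < b`, which index the tangential infinitesimal rotations `R_ab`. -/
abbrev Pairs (m : ℕ) : Type := {q : Fin m × Fin m // q.1 < q.2}

/-- The eight blocks. Rows: `N`; `E_i`; `R_ab` for `a < b`; `R_ni`. Columns: `dr`; `ω_j`. -/
structure Blocks (m : ℕ) where
  /-- `E_i ⊗ ω_j` -/
  A : Matrix (Fin m) (Fin m) ℝ
  /-- `R_ni ⊗ ω_j` -/
  B : Matrix (Fin m) (Fin m) ℝ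
  /-- `R_ni ⊗ dr` -/
  C : Matrix (Fin m) (Fin 1) ℝ
  /-- `R_ab ⊗ dr` -/
  D : Matrix (Pairs m) (Fin 1) ℝ
  /-- `E_i ⊗ dr` -/
  E : Matrix (Fin m) (Fin 1) ℝ
  /-- `N ⊗ dr` -/
  F : Matrix (Fin 1) (Fin 1) ℝ
  /-- `N ⊗ ω_j` -/
  G : Matrix (Fin 1) (Fin m) ℝ
  /-- `R_ab ⊗ ω_j` -/
  H : Matrix (Pairs m) (Fin m) ℝ

/-- The element of the fibre of `E` at the boundary point `p` which has coefficients `cN, cE, cT, cR`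
with respect to `N`, `E_i`, `R_ab` (`a < b`), `R_ni`, for the frame `n, e_1, …, e_m` at `p`. -/
def combination (p : W) (hp : p ∈ bdry m W) (e : Fin m → TangentAt m p)
    (cN : ℝ) (cE : Fin m → ℝ) (cT : Pairs m → ℝ) (cR : Fin m → ℝ) : EFiber m p :=
  cN • transl (base m p) (outwardNormal m p hp) + ∑ i, cE i • transl (base m p) (e i)
    + ∑ q, cT q • rotation (base m p) (e q.1.1) (e q.1.2)
    + ∑ i, cR i • rotation (base m p) (outwardNormal m p hp) (e i)

/-- `β` is the block decomposition of the 1-form `ω` at `p` relative to the frame `n, e_1, …, e_m`: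
`ω(n)` is the `dr` column and `ω(e_j)` is the `ω_j` column. -/
def IsBlockDecomposition (ω : EForm m W) (p : W) (hp : p ∈ bdry m W)
    (e : Fin m → TangentAt m p) (β : Blocks m) : Prop :=
  (ω.toForm p (fun _ => outwardNormal m p hp) =
    combination p hp e (β.F 0 0) (fun i => β.E i 0) (fun q => β.D q 0) (fun i => β.C i 0)) ∧
  ∀ j, ω.toForm p (fun _ => e j) =
    combination p hp e (β.G 0 j) (fun i => β.A i j) (fun q => β.H q j) (fun i => β.B i j)

end Manifold

/-- The dot product of two matrices of the same shape. -/
def matDot {ι κ : Type*} [Fintype ι] [Fintype κ] (X Y : Matrix ι κ ℝ) : ℝ :=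
  ∑ i, ∑ j, X i j * Y i j

/-- The matrix of the skew-symmetric transformation `∑_{a<b} D_ab R_ab` of `ℝ^m`, where `R_ab` takes
`e_b` to `e_a` and `e_a` to `-e_b`. -/
def skew {m : ℕ} (D : Matrix (Pairs m) (Fin 1) ℝ) : Matrix (Fin m) (Fin m) ℝ :=
  ∑ q : Pairs m, D q 0 • (Matrix.single q.1.1 q.1.2 1 - Matrix.single q.1.2 q.1.1 1)

/-- The coefficient of `R_ab`, `a < b`, in `R_ij` (with `R_ii = 0` and `R_ij = -R_ji`). -/
def rotCoeff {m : ℕ} (q : Pairs m) (i j : Fin m) : ℝ :=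
  if i = q.1.1 ∧ j = q.1.2 then 1 else if i = q.1.2 ∧ j = q.1.1 then -1 else 0

/-- The matrix, with respect to the `R_ab ⊗ ω_j`, of the image of `∑ E_i e_i` under the linear map
with `e_i ↦ ∑_j R_ij ⊗ ω_j`. -/
def rot {m : ℕ} (E : Matrix (Fin m) (Fin 1) ℝ) : Matrix (Pairs m) (Fin m) ℝ :=
  Matrix.of fun q j => ∑ i, E i 0 * rotCoeff q i j

/-- The function
`G·Cᵀ + A·B + A·skew(D) + H·rot(E) + B·A + B·F(Id)` of the blocks. -/
def Blocks.integrand {m : ℕ} (β : Blocks m) : ℝ :=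
  matDot β.G β.Cᵀ + matDot β.A β.B + matDot β.A (skew β.D) + matDot β.H (rot β.E)
    + matDot β.B β.A + matDot β.B (β.F 0 0 • (1 : Matrix (Fin m) (Fin m) ℝ))

end Hyp

end

namespace Hyp

attribute [local instance] LieRing.ofAssociativeRing

/-! ### Wedge products, contractions and the Hodge star -/

section Exterior

variable {V N₁ N₂ N : Type*} [AddCommGroup V] [Module ℝ V] [AddCommGroup N₁] [Module ℝ N₁]
  [AddCommGroup N₂] [Module ℝ N₂] [AddCommGroup N] [Module ℝ N]

/-! The claim is pointwise and algebraic, and it separates into a statement on forms and a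
computation in the Lie algebra.

Forms. Let `α` be a 1-form and `β` a 2-form, and evaluate `α ∧ ⋆β` on an orthonormal basis `e` of
the boundary tangent space. In the expansion, `α` receives one vector `e_s` and `⋆β` the other `m -
1`. The vectors of the frame `n, e_1, …, e_m` missing from the latter are `n` and `e_s`, so `⋆β`
returns `± β(n, e_s)`. Its sign cancels the sign of the shuffle, and the outcome is `∑ₛ ⟨α(e_s),
β(n, e_s)⟩ vol_M(e)`, see `wedge_hodgeStar_boundary`. No extra sign appears because `vol_M` is
`vol_W` with `n` in the first slot.

Lie algebra. By `opT_one_apply`, `Tω(n, e_s) = [N, ω(e_s)] - [E_s, ω(n)]`. Translations bracket to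
rotations by definition, and `[E_w, R(u,v)]` is again a translation by `lie_transl_rotation`. Thus
`[N, ·]` exchanges `E_i` and `R_ni` and kills `N` and `R_ab`, which gives `A·B + B·A`. The four
parts `F, E, D, C` of `ω(n)`, bracketed with `E_s`, pair with the blocks `B, H, A, G` of `ω(e_s)`
and give the other four terms; see `sum_fiberMetric_opT`.

Existence and uniqueness of the blocks hold because `N, E_i, R_ab, R_ni` is an orthonormal basis of
the fibre. It spans since an element of `𝔤` orthogonal to all translations and rotations at `x`
kills both `x` and `T_xℍ` (`eq_zero_of_fiberMetric`). -/

lemma alternatingMap_sum_apply {ι κ : Type*} (s : Finset κ) (f : κ → V [⋀^ι]→ₗ[ℝ] N)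
    (w : ι → V) : (∑ i ∈ s, f i) w = ∑ i ∈ s, f i w := by
  classical
  induction s using Finset.induction_on with
  | empty => simp
  | insert a s ha ih => rw [Finset.sum_insert ha, Finset.sum_insert ha, AlternatingMap.add_apply, ih]

/-- The wedge product as a sum over all permutations. -/
lemma factorial_smul_wedge_apply (B : N₁ →ₗ[ℝ] N₂ →ₗ[ℝ] N) {a b c : ℕ} (h : a + b = c)
    (α : V [⋀^Fin a]→ₗ[ℝ] N₁) (β : V [⋀^Fin b]→ₗ[ℝ] N₂) (w : Fin c → V) :
    (a.factorial * b.factorial) • wedge B h α β w =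
      ∑ σ : Equiv.Perm (Fin c), Equiv.Perm.sign σ •
        B (α fun i => w (σ (Fin.cast h (Fin.castAdd b i))))
          (β fun j => w (σ (Fin.cast h (Fin.natAdd a j)))) := by
  subst h
  -- `domCoprod` sums over shuffles. Since `α` and `β` are alternating, the sum over all
  -- permutations counts each shuffle `a! b!` times.
  have h1 := MultilinearMap.domCoprod_alternization_eq α β
  simp only [Fintype.card_fin] at h1
  have h2 : (a.factorial * b.factorial) • wedge B rfl α β w =
      TensorProduct.lift B (((a.factorial * b.factorial) • α.domCoprod β) (w ∘ finSumFinEquiv)) := by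
    rw [AlternatingMap.smul_apply, map_nsmul]
    rfl
  rw [h2, ← h1, MultilinearMap.alternatization_apply, map_sum]
  refine Fintype.sum_equiv (finSumFinEquiv (m := a) (n := b)).permCongr _ _ fun σ => ?_
  rw [Equiv.Perm.sign_permCongr]
  simp only [Units.smul_def, map_zsmul]
  simp [MultilinearMap.domCoprod_apply, Equiv.permCongr_apply]

/-- The wedge product of two 1-forms. -/
lemma wedge_one_one_apply (B : N₁ →ₗ[ℝ] N₂ →ₗ[ℝ] N) (α : V [⋀^Fin 1]→ₗ[ℝ] N₁)
    (β : V [⋀^Fin 1]→ₗ[ℝ] N₂) (u v : V) :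
    wedge B (rfl : 1 + 1 = 1 + 1) α β ![u, v] =
      B (α fun _ => u) (β fun _ => v) - B (α fun _ => v) (β fun _ => u) := by
  have h := factorial_smul_wedge_apply B (rfl : 1 + 1 = 1 + 1) α β ![u, v]
  simp only [Nat.factorial_one, mul_one, one_smul] at h
  rw [h]
  have h2 : (Finset.univ : Finset (Equiv.Perm (Fin (1 + 1)))) = {1, Equiv.swap 0 1} := by decide
  have hne : (1 : Equiv.Perm (Fin (1 + 1))) ≠ Equiv.swap 0 1 := by decide
  rw [h2, Finset.sum_pair hne, sub_eq_add_neg]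
  have e0 : ∀ i : Fin 1, Fin.castAdd 1 i = (0 : Fin (1 + 1)) := by decide
  have e1 : Fin.natAdd 1 (0 : Fin 1) = (1 : Fin (1 + 1)) := rfl
  have hs : Equiv.Perm.sign (Equiv.swap (0 : Fin (1 + 1)) 1) = -1 :=
    Equiv.Perm.sign_swap (by decide)
  have c : ∀ w : Fin 1 → V, w = fun _ => w 0 := fun w => by
    funext i; rw [Subsingleton.elim i 0]
  rw [c fun j => ![u, v] (Equiv.swap (0 : Fin (1 + 1)) 1 (Fin.cast rfl (Fin.natAdd 1 j))),
    c fun j => ![u, v] ((1 : Equiv.Perm (Fin (1 + 1))) (Fin.cast rfl (Fin.natAdd 1 j)))]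
  simp only [Fin.cast_eq_self, e0, e1, hs]
  simp

/-- The wedge product of a 1-form with an `l`-form. -/
lemma factorial_smul_wedge_one_apply (B : N₁ →ₗ[ℝ] N₂ →ₗ[ℝ] N) {l : ℕ} (h : 1 + l = l + 1)
    (α : V [⋀^Fin 1]→ₗ[ℝ] N₁) (β : V [⋀^Fin l]→ₗ[ℝ] N₂) (w : Fin (l + 1) → V) :
    l.factorial • wedge B h α β w =
      ∑ σ : Equiv.Perm (Fin (l + 1)), Equiv.Perm.sign σ •
        B (α fun _ => w (σ 0)) (β fun j => w (σ j.succ)) := by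
  have h1 := factorial_smul_wedge_apply B h α β w
  rw [Nat.factorial_one, one_mul] at h1
  rw [h1]
  have e0 : ∀ i : Fin 1, Fin.cast h (Fin.castAdd l i) = 0 := by
    intro i; ext; simp
  have e1 : ∀ j : Fin l, Fin.cast h (Fin.natAdd 1 j) = j.succ := by
    intro j; ext; simp
  simp only [e0, e1]

lemma contract_two_apply {l : ℕ} (h : 2 + l = l + 2) (ν : V [⋀^Fin (l + 2)]→ₗ[ℝ] ℝ)
    (u v : V) (w : Fin l → V) :
    contract h ν ![u, v] w = ν (Matrix.vecCons u (Matrix.vecCons v w)) := by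
  change ν (Sum.elim ![u, v] w ∘ (finSumFinEquiv.trans (finCongr h)).symm) = _
  congr 1
  rw [Equiv.comp_symm_eq]
  funext s
  rcases s with i | j
  · fin_cases i <;> rfl
  · have : (finSumFinEquiv.trans (finCongr h)) (Sum.inr j : Fin 2 ⊕ Fin l) = j.succ.succ := by
      ext; simp
    rw [Function.comp_apply, this]
    rfl

end Exterior

/-! ### The Hodge star of a 2-form in an arbitrary orthonormal basis -/

section Hodge

variable {V F : Type*} [NormedAddCommGroup V] [InnerProductSpace ℝ V] [FiniteDimensional ℝ V]
  [AddCommGroup F] [Module ℝ F]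

/-- The trace of a bilinear map does not depend on the orthonormal basis. -/
lemma sum_bilin_orthonormalBasis {ι κ : Type*} [Fintype ι] [Fintype κ]
    (b : OrthonormalBasis ι ℝ V) (g : OrthonormalBasis κ ℝ V) (Φ : V →ₗ[ℝ] V →ₗ[ℝ] F) :
    ∑ i, Φ (b i) (b i) = ∑ a, Φ (g a) (g a) := by
  -- The tensor `∑ bᵢ ⊗ bᵢ` is dual to the metric, hence the same for every orthonormal basis.
  have h := congrArg (TensorProduct.lift Φ)
    ((InnerProductSpace.canonicalCovariantTensor_eq_sum V b).symm.trans
      (InnerProductSpace.canonicalCovariantTensor_eq_sum V g))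
  simpa using h

/-- Invariance of the trace is applied twice: the summand is bilinear in the two occurrences of `b
j`, and then in those of `b i`. -/
lemma sum_contract_orthonormalBasis {ι κ : Type*} [Fintype ι] [Fintype κ]
    (b : OrthonormalBasis ι ℝ V) (g : OrthonormalBasis κ ℝ V) {l : ℕ}
    (ν : V [⋀^Fin (l + 2)]→ₗ[ℝ] ℝ) (β : V [⋀^Fin 2]→ₗ[ℝ] F) (w : Fin l → V) :
    ∑ i, ∑ j, ν (Matrix.vecCons (b i) (Matrix.vecCons (b j) w)) • β ![b i, b j] =
      ∑ i, ∑ j, ν (Matrix.vecCons (g i) (Matrix.vecCons (g j) w)) • β ![g i, g j] := by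
  have inner : ∀ u u' : V,
      ∑ j, ν (Matrix.vecCons u (Matrix.vecCons (b j) w)) • β ![u', b j] =
      ∑ j, ν (Matrix.vecCons u (Matrix.vecCons (g j) w)) • β ![u', g j] := by
    intro u u'
    refine sum_bilin_orthonormalBasis b g (LinearMap.mk₂ ℝ
      (fun v v' => ν.curryLeft u (Matrix.vecCons v w) • β.curryLeft u' ![v']) ?_ ?_ ?_ ?_)
    · intro x y z; rw [AlternatingMap.map_vecCons_add, add_smul]
    · intro c x z; rw [AlternatingMap.map_vecCons_smul, smul_assoc]
    · intro x y z; rw [AlternatingMap.map_vecCons_add, smul_add]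
    · intro c x z; rw [AlternatingMap.map_vecCons_smul, smul_comm]
  simp only [inner]
  refine sum_bilin_orthonormalBasis b g (LinearMap.mk₂ ℝ
    (fun u u' => ∑ j, ν (Matrix.vecCons u (Matrix.vecCons (g j) w)) • β ![u', g j]) ?_ ?_ ?_ ?_)
  · intro x y z
    simp only [AlternatingMap.map_vecCons_add, add_smul, Finset.sum_add_distrib]
  · intro c x z
    simp only [AlternatingMap.map_vecCons_smul, smul_assoc, Finset.smul_sum]
  · intro x y z
    simp only [AlternatingMap.map_vecCons_add, smul_add, Finset.sum_add_distrib]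
  · intro c x z
    simp only [AlternatingMap.map_vecCons_smul, smul_comm _ c, Finset.smul_sum]

/-- The Hodge star of a 2-form, on the last `l` vectors of an orthonormal basis. -/
lemma hodgeStar_two_apply {l : ℕ} [Fact (Module.finrank ℝ V = l + 2)]
    (o : Orientation ℝ V (Fin (l + 2))) (h : 2 + l = l + 2) (β : V [⋀^Fin 2]→ₗ[ℝ] F)
    (g : OrthonormalBasis (Fin (l + 2)) ℝ V) :
    hodgeStar o h β (fun k => g k.succ.succ) = o.volumeForm g • β ![g 0, g 1] := by
  set ν := o.volumeForm with hν
  set w : Fin l → V := fun k => g k.succ.succ with hw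
  have h1 : hodgeStar o h β w = (2 : ℝ)⁻¹ • ∑ i, ∑ j,
      ν (Matrix.vecCons (g i) (Matrix.vecCons (g j) w)) • β ![g i, g j] := by
    rw [← sum_contract_orthonormalBasis (stdOrthonormalBasis ℝ V) g, ← Fintype.sum_prod_type']
    simp only [hodgeStar, Nat.factorial_two, AlternatingMap.smul_apply, Nat.cast_ofNat]
    congr 1
    rw [alternatingMap_sum_apply]
    refine Fintype.sum_equiv (finTwoArrowEquiv _) _ _ fun i => ?_
    have e : (fun s => stdOrthonormalBasis ℝ V (i s)) =
        ![stdOrthonormalBasis ℝ V (i 0), stdOrthonormalBasis ℝ V (i 1)] := by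
      funext s; fin_cases s <;> rfl
    rw [e, ← hν]
    simp only [LinearMap.compAlternatingMap_apply, contract_two_apply,
      LinearMap.toSpanSingleton_apply]
    rfl
  have hg : (Matrix.vecCons (g 0) (Matrix.vecCons (g 1) w) : Fin (l + 2) → V) = g := by
    funext k
    refine Fin.cases rfl (fun k => ?_) k
    refine Fin.cases rfl (fun k => rfl) k
  have hg' : ν (Matrix.vecCons (g 1) (Matrix.vecCons (g 0) w)) = -ν g := by
    have hc : (Matrix.vecCons (g 1) (Matrix.vecCons (g 0) w) : Fin (l + 2) → V) =
        g ∘ Equiv.swap 0 1 := by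
      funext k
      refine Fin.cases (by simp) (fun k => ?_) k
      refine Fin.cases (by simp) (fun k => ?_) k
      rw [Function.comp_apply, Equiv.swap_apply_of_ne_of_ne (Fin.succ_ne_zero _)]
      · rfl
      · intro hk
        exact Fin.succ_ne_zero k (Fin.succ_injective _ hk)
    rw [hc, AlternatingMap.map_swap _ _ (by simp)]
  have hβ : β ![g 1, g 0] = -β ![g 0, g 1] := by
    have hc : ![g 1, g 0] = ![g 0, g 1] ∘ Equiv.swap 0 1 := by
      funext s; fin_cases s <;> simp
    rw [hc, AlternatingMap.map_swap _ _ (by simp)]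
  -- A nonzero term needs two distinct basis vectors outside `w`, so only `(g 0, g 1)` and `(g 1, g
  -- 0)` remain. Both signs flip together, the two terms agree, and their sum cancels the factor
  -- `1/2!`.
  have hd : ∀ u, ν (Matrix.vecCons u (Matrix.vecCons u w)) = 0 := fun u =>
    ν.map_eq_zero_of_eq _ (i := 0) (j := 1) rfl (by simp)
  have hi : ∀ (k : Fin l) u, ν (Matrix.vecCons (g k.succ.succ) (Matrix.vecCons u w)) = 0 :=
    fun k u => ν.map_eq_zero_of_eq _ (i := 0) (j := k.succ.succ) rfl (Fin.succ_ne_zero _).symm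
  have hj : ∀ (k : Fin l) u, ν (Matrix.vecCons u (Matrix.vecCons (g k.succ.succ) w)) = 0 :=
    fun k u => ν.map_eq_zero_of_eq _ (i := Fin.succ 0) (j := k.succ.succ) rfl
      fun hk => (Fin.succ_ne_zero k) (Fin.succ_injective _ hk).symm
  rw [h1]
  simp only [Fin.sum_univ_succ, hi, hj, hd, zero_smul, Finset.sum_const_zero, add_zero, zero_add]
  have e1 : Fin.succ (0 : Fin (l + 1)) = 1 := rfl
  rw [e1, hg, hg', hβ, smul_neg, neg_smul, neg_neg, ← two_smul ℝ, smul_smul]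
  norm_num

end Hodge

/-! ### Brackets and pairings of infinitesimal translations and rotations -/

section Algebra

variable {m : ℕ} (x : HalfSpace m)

/-- As `x` is orthogonal to tangent vectors, only the terms with `⟨u,w⟩` and `⟨v,w⟩` survive in
`translMatrix_mul`. Together with the definition of `rotation`, this supplies every bracket that
occurs in `Tω`. -/
lemma lie_transl_rotation (w u v : HTangent x) :
    ⁅transl x w, rotation x u v⁆ = transl x (inner ℝ u w • v - inner ℝ v w • u) := by
  apply Subtype.ext
  have h : (⁅transl x w, rotation x u v⁆ : so1 m).1 =
      translMatrix x.pt w.vec * (rotation x u v).1 -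
        (rotation x u v).1 * translMatrix x.pt w.vec := rfl
  have h' : (transl x (inner ℝ u w • v - inner ℝ v w • u)).1 =
      translMatrix x.pt (inner ℝ u w • v - inner ℝ v w • u).vec := rfl
  rw [h, h', rotation_val, translMatrix_mul, translMatrix_mul, u.lor_vec, v.lor_vec,
    lor_comm u.vec x.pt, lor_comm v.vec x.pt, u.lor_vec, v.lor_vec, inner_eq_lor, inner_eq_lor,
    lor_comm w.vec u.vec, lor_comm w.vec v.vec]
  ext i j
  simp [translMatrix, Matrix.vecMulVec_apply, Matrix.mulVec_sub, Matrix.mulVec_smul]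
  ring

lemma rotation_swap (u v : HTangent x) : rotation x v u = -rotation x u v :=
  (lie_skew _ _).symm

lemma rotation_self (u : HTangent x) : rotation x u u = 0 := lie_self _

lemma fiberMetric_comm (A B : so1 m) : fiberMetric x A B = fiberMetric x B A := by
  simp only [fiberMetric, LinearMap.mk₂_apply]
  congr 1
  rw [Matrix.mul_assoc (A.1 * _), Matrix.trace_mul_comm, ← Matrix.mul_assoc]

lemma fiberMetric_rot_transl (u v w : HTangent x) :
    fiberMetric x (rotation x v w) (transl x u) = 0 := by
  rw [fiberMetric_comm, fiberMetric_transl_rot]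

/-- Elements of `𝔤` are skew for the Lorentz form. -/
lemma so1_lor (X : so1 m) (a b : Mink m) : lor (X.1 *ᵥ a) b = -lor a (X.1 *ᵥ b) := by
  have h := X.2
  rw [mem_skewAdjointMatricesLieSubalgebra, mem_skewAdjointMatricesSubmodule] at h
  simp only [Matrix.IsSkewAdjoint, Matrix.IsAdjointPair] at h
  have h2 : (X.1 *ᵥ a) ⬝ᵥ (J m *ᵥ b) = a ⬝ᵥ ((X.1ᵀ * J m) *ᵥ b) := by
    rw [← Matrix.mulVec_mulVec, Matrix.dotProduct_mulVec a, Matrix.vecMul_transpose]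
  rw [lor, h2, h, lor, mul_neg, Matrix.neg_mulVec, dotProduct_neg, Matrix.mulVec_mulVec]

lemma trace_mul_translMatrix (X : Matrix (Fin (m + 2)) (Fin (m + 2)) ℝ) (u v : Mink m) :
    (X * translMatrix u v).trace = lor (X *ᵥ u) v - lor (X *ᵥ v) u := by
  rw [translMatrix, mul_sub, Matrix.mul_vecMulVec, Matrix.mul_vecMulVec, Matrix.trace_sub,
    trace_vecMulVec_J, trace_vecMulVec_J]

/-- Conjugation by the point reflection fixes `x` and negates tangent vectors, so the trace reads
off the tangential part of `X x`. With the next lemma, pairings become matrix entries of `X` for the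
splitting `ℝx ⊕ T_xℍ`. -/
lemma fiberMetric_transl_right (X : so1 m) (u : HTangent x) :
    fiberMetric x X (transl x u) = lor (X.1 *ᵥ x.pt) u.vec := by
  have h : (transl x u).1 = translMatrix x.pt u.vec := rfl
  rw [fiberMetric_eq, h, pointReflection_conj, reflect_pt, reflect_vec, trace_mul_translMatrix,
    lor_neg, Matrix.mulVec_neg, lor_comm (-(X.1 *ᵥ u.vec)), lor_neg, lor_comm x.pt, so1_lor,
    lor_comm (X.1 *ᵥ u.vec)]
  ring

lemma fiberMetric_rotation_right (X : so1 m) (u v : HTangent x) :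
    fiberMetric x X (rotation x u v) = -lor (X.1 *ᵥ u.vec) v.vec := by
  rw [fiberMetric_eq, rotation_val, pointReflection_conj, reflect_vec, reflect_vec,
    trace_mul_translMatrix]
  have h1 : ∀ a b : Mink m, lor (X.1 *ᵥ -a) (-b) = lor (X.1 *ᵥ a) b := fun a b => by
    rw [Matrix.mulVec_neg, lor_neg, lor_comm, lor_neg, neg_neg, lor_comm]
  have h2 : lor (X.1 *ᵥ v.vec) u.vec = -lor (X.1 *ᵥ u.vec) v.vec := by
    rw [so1_lor, lor_comm]
  rw [h1, h1, h2]
  ring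

lemma lor_nondegenerate {a : Mink m} (h : ∀ b, lor b a = 0) : a = 0 := by
  have h1 : J m *ᵥ a = 0 := dotProduct_eq_zero_iff.mp fun b => by
    rw [dotProduct_comm]; exact h b
  funext i
  have h2 := congrFun h1 i
  simp only [J, Matrix.mulVec_diagonal, Pi.zero_apply] at h2
  split_ifs at h2 <;> simpa using h2

/-- Minkowski space is spanned by `x` and the tangent space at `x`. -/
lemma exists_eq_smul_pt_add_vec (a : Mink m) : ∃ (c : ℝ) (u : HTangent x), a = c • x.pt + u.vec :=
  ⟨-lor x.pt a, ⟨a + lor x.pt a • x.pt, by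
    change lor x.pt (a + lor x.pt a • x.pt) = 0
    rw [lor_add, lor_smul, lor_pt]; ring⟩, by
    change a = -lor x.pt a • x.pt + (a + lor x.pt a • x.pt)
    module⟩

/-- Infinitesimal translations and rotations at `x` span `𝔤`: only `0` is orthogonal to all. -/
lemma eq_zero_of_fiberMetric (X : so1 m) (h1 : ∀ u, fiberMetric x X (transl x u) = 0)
    (h2 : ∀ u v, fiberMetric x X (rotation x u v) = 0) : X = 0 := by
  have hxx : lor x.pt (X.1 *ᵥ x.pt) = 0 := by
    have := so1_lor X x.pt x.pt
    rw [lor_comm] at this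
    linarith
  -- Both arguments are split along `ℝx ⊕ T_xℍ`. The `x, x` entry vanishes by skewness, the mixed
  -- entries by `h1` and skewness, the tangential ones by `h2`.
  have key : ∀ a b, lor b (X.1 *ᵥ a) = 0 := by
    intro a b
    obtain ⟨c, u, rfl⟩ := exists_eq_smul_pt_add_vec x a
    obtain ⟨d, v, rfl⟩ := exists_eq_smul_pt_add_vec x b
    have h3 : ∀ u : HTangent x, lor (X.1 *ᵥ x.pt) u.vec = 0 := fun u => by
      rw [← fiberMetric_transl_right, h1]
    have h4 : lor (X.1 *ᵥ u.vec) v.vec = 0 := by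
      have := fiberMetric_rotation_right x X u v
      rw [h2] at this; linarith
    have h5 : lor (X.1 *ᵥ u.vec) x.pt = 0 := by
      rw [so1_lor, lor_comm, h3, neg_zero]
    rw [lor_comm, Matrix.mulVec_add, Matrix.mulVec_smul, lor_comm, lor_add, lor_smul]
    rw [lor_comm _ (X.1 *ᵥ x.pt), lor_comm _ (X.1 *ᵥ u.vec)]
    simp only [lor_add, lor_smul, h3, h4, h5, lor_comm _ x.pt, hxx]
    ring
  apply Subtype.ext
  refine Matrix.ext_of_mulVec_single fun j => ?_
  rw [lor_nondegenerate (key (Pi.single j 1))]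
  exact (Matrix.zero_mulVec _).symm

end Algebra

/-- The operator `T` on 1-forms. -/
lemma opT_one_apply {m : ℕ} (x : HalfSpace m) (α : HTangent x [⋀^Fin 1]→ₗ[ℝ] so1 m)
    (u v : HTangent x) :
    opT x α ![u, v] = ⁅transl x u, α fun _ => v⁆ - ⁅transl x v, α fun _ => u⁆ := by
  -- Expanding `u` in the frame turns `∑ⱼ ωⱼ(u) ad(Eⱼ)` into `ad(E_u)`, which eliminates the frame.
  have h : ∀ (u : HTangent x) (X : so1 m),
      ∑ j, inner ℝ (stdOrthonormalBasis ℝ (HTangent x) j) u •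
        ⁅transl x (stdOrthonormalBasis ℝ (HTangent x) j), X⁆ = ⁅transl x u, X⁆ := by
    intro u X
    conv_rhs => rw [← (stdOrthonormalBasis ℝ (HTangent x)).sum_repr' u]
    simp only [map_sum, map_smul, sum_lie, smul_lie]
  rw [opT, alternatingMap_sum_apply]
  simp only [wedge_one_one_apply]
  rw [← h u, ← h v, ← Finset.sum_sub_distrib]
  rfl

/-! ### The frame at a boundary point and the induced frame of the fibre -/

section Frame

variable {m : ℕ} {W : Type*} [TopologicalSpace W] [ChartedSpace (HalfSpace m) W]
  (p : W) (hp : p ∈ bdry m W)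

lemma inner_outwardNormal (v : TangentAt m p) :
    inner ℝ (outwardNormal m p hp) v = -v.vec 1 := by
  rw [inner_eq_lor, lor_comm]
  change lor v.vec (-Pi.single 1 1) = _
  rw [lor_neg, lor_single_one]

lemma inner_outwardNormal_self :
    inner ℝ (outwardNormal m p hp) (outwardNormal m p hp) = 1 := by
  rw [inner_outwardNormal]
  change -(-(Pi.single 1 1 : Mink m)) 1 = 1
  simp

lemma inner_outwardNormal_bdryTangent (v : bdryTangent m p) :
    inner ℝ (outwardNormal m p hp) (v : TangentAt m p) = 0 := by
  rw [inner_outwardNormal, neg_eq_zero]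
  exact v.2

variable (e : OrthonormalBasis (Fin m) ℝ (bdryTangent m p))

lemma inner_coe_basis (i j : Fin m) :
    inner ℝ (e i : TangentAt m p) (e j : TangentAt m p) = if i = j then 1 else 0 :=
  orthonormal_iff_ite.mp e.orthonormal i j

lemma orthonormal_cons_outwardNormal :
    Orthonormal ℝ (Fin.cons (outwardNormal m p hp) (fun i => (e i : TangentAt m p)) :
      Fin (m + 1) → TangentAt m p) := by
  rw [orthonormal_iff_ite]
  intro i j
  refine Fin.cases ?_ (fun i => ?_) i <;> refine Fin.cases ?_ (fun j => ?_) j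
  · simpa using inner_outwardNormal_self p hp
  · simpa [(Fin.succ_ne_zero j).symm] using inner_outwardNormal_bdryTangent p hp (e j)
  · simpa [real_inner_comm] using inner_outwardNormal_bdryTangent p hp (e i)
  · simpa using inner_coe_basis p e i j

/-- The orthonormal frame `n, e_1, …, e_m` at a boundary point. -/
noncomputable def boundaryFrame : OrthonormalBasis (Fin (m + 1)) ℝ (TangentAt m p) :=
  OrthonormalBasis.mk (orthonormal_cons_outwardNormal p hp e) (by
    refine ((orthonormal_cons_outwardNormal p hp
      e).linearIndependent.span_eq_top_of_card_eq_finrank ?_).ge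
    rw [Fintype.card_fin, (finrank_tangent (base m p)).out])

lemma coe_boundaryFrame : (boundaryFrame p hp e : Fin (m + 1) → TangentAt m p) =
    Fin.cons (outwardNormal m p hp) (fun i => (e i : TangentAt m p)) :=
  OrthonormalBasis.coe_mk _ _

/-! ### Coefficients in the fibre -/

variable (cN : ℝ) (cE : Fin m → ℝ) (cT : Pairs m → ℝ) (cR : Fin m → ℝ)

local notation "𝐧" => outwardNormal m p hp
local notation "𝐜" => combination p hp (fun i => (e i : TangentAt m p)) cN cE cT cR

lemma fiberMetric_combination_left (Y : EFiber m p) :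
    fiberMetric (base m p) 𝐜 Y = cN * fiberMetric (base m p) (transl (base m p) 𝐧) Y
      + ∑ i, cE i * fiberMetric (base m p) (transl (base m p) (e i)) Y
      + ∑ q, cT q * fiberMetric (base m p) (rotation (base m p) (e q.1.1) (e q.1.2)) Y
      + ∑ i, cR i * fiberMetric (base m p) (rotation (base m p) 𝐧 (e i)) Y := by
  simp only [combination, map_add, map_sum, map_smul, LinearMap.add_apply, LinearMap.sum_apply,
    LinearMap.smul_apply, smul_eq_mul]

lemma fiberMetric_combination_transl_normal :
    fiberMetric (base m p) 𝐜 (transl (base m p) 𝐧) = cN := by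
  simp only [fiberMetric_combination_left, fiberMetric_transl, fiberMetric_rot_transl,
    inner_outwardNormal_self, real_inner_comm 𝐧, inner_outwardNormal_bdryTangent]
  simp

lemma fiberMetric_combination_transl (j : Fin m) :
    fiberMetric (base m p) 𝐜 (transl (base m p) (e j)) = cE j := by
  simp only [fiberMetric_combination_left, fiberMetric_transl, fiberMetric_rot_transl,
    inner_outwardNormal_bdryTangent, inner_coe_basis]
  simp

lemma fiberMetric_combination_rotation_normal (j : Fin m) :
    fiberMetric (base m p) 𝐜 (rotation (base m p) 𝐧 (e j)) = cR j := by
  simp only [fiberMetric_combination_left, fiberMetric_transl_rot, fiberMetric_rot,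
    inner_outwardNormal_self, real_inner_comm 𝐧, inner_outwardNormal_bdryTangent, inner_coe_basis]
  simp

/-- All `i, j` are needed, not only `i < j`: bracketing `E_s` with `E_i` yields `R_si` in either
order, and `rotCoeff` carries the sign. -/
lemma fiberMetric_combination_rotation (i j : Fin m) :
    fiberMetric (base m p) 𝐜 (rotation (base m p) (e i) (e j)) =
      ∑ q, cT q * rotCoeff q i j := by
  simp only [fiberMetric_combination_left, fiberMetric_transl_rot, fiberMetric_rot,
    inner_outwardNormal_bdryTangent, inner_coe_basis]
  simp only [mul_zero, zero_mul, sub_zero, Finset.sum_const_zero, zero_add, add_zero]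
  refine Finset.sum_congr rfl fun q _ => ?_
  obtain ⟨⟨a, b⟩, h⟩ := q
  simp only at h
  simp only [rotCoeff]
  congr 1
  split_ifs <;> first | omega | simp

lemma rotCoeff_pair (q q' : Pairs m) : rotCoeff q q'.1.1 q'.1.2 = if q = q' then 1 else 0 := by
  obtain ⟨⟨a, b⟩, h⟩ := q
  obtain ⟨⟨c, d⟩, h'⟩ := q'
  simp only [rotCoeff, Subtype.mk.injEq, Prod.mk.injEq]
  simp only at h h'
  split_ifs <;> first | rfl | omega

lemma rotCoeff_swap (q : Pairs m) (i j : Fin m) : rotCoeff q i j = -rotCoeff q j i := by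
  obtain ⟨⟨a, b⟩, h⟩ := q
  simp only [rotCoeff]
  simp only at h
  split_ifs <;> first | omega | simp

lemma fiberMetric_combination_rotation_pair (q : Pairs m) :
    fiberMetric (base m p) 𝐜 (rotation (base m p) (e q.1.1) (e q.1.2)) = cT q := by
  rw [fiberMetric_combination_rotation]
  simp [rotCoeff_pair]

/-- An element of the fibre is determined by its pairings with the frame of the fibre. -/
lemma eq_combination (X : EFiber m p) :
    X = combination p hp (fun i => (e i : TangentAt m p))
      (fiberMetric (base m p) X (transl (base m p) 𝐧))
      (fun i => fiberMetric (base m p) X (transl (base m p) (e i)))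
      (fun q => fiberMetric (base m p) X (rotation (base m p) (e q.1.1) (e q.1.2)))
      (fun i => fiberMetric (base m p) X (rotation (base m p) 𝐧 (e i))) := by
  rw [← sub_eq_zero]
  set Y := X - combination p hp _ _ _ _ _ with hY
  have h1 : fiberMetric (base m p) Y (transl (base m p) 𝐧) = 0 := by
    rw [hY, map_sub, LinearMap.sub_apply, fiberMetric_combination_transl_normal, sub_self]
  have h2 : ∀ i, fiberMetric (base m p) Y (transl (base m p) (e i)) = 0 := fun i => by
    rw [hY, map_sub, LinearMap.sub_apply, fiberMetric_combination_transl, sub_self]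
  have h3 : ∀ q : Pairs m,
      fiberMetric (base m p) Y (rotation (base m p) (e q.1.1) (e q.1.2)) = 0 := fun q => by
    rw [hY, map_sub, LinearMap.sub_apply, fiberMetric_combination_rotation_pair, sub_self]
  have h4 : ∀ i, fiberMetric (base m p) Y (rotation (base m p) 𝐧 (e i)) = 0 := fun i => by
    rw [hY, map_sub, LinearMap.sub_apply, fiberMetric_combination_rotation_normal, sub_self]
  have h5 : ∀ i j, fiberMetric (base m p) Y (rotation (base m p) (e i) (e j)) = 0 := by
    intro i j
    rcases lt_trichotomy i j with h | h | h
    · exact h3 ⟨(i, j), h⟩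
    · rw [h, rotation_self, map_zero]
    · rw [rotation_swap, map_neg, h3 ⟨(j, i), h⟩, neg_zero]
  have f0 : boundaryFrame p hp e 0 = 𝐧 := by rw [coe_boundaryFrame]; rfl
  have fs : ∀ i : Fin m, boundaryFrame p hp e i.succ = (e i : TangentAt m p) := fun i => by
    rw [coe_boundaryFrame]; rfl
  have g1 : ∀ i, fiberMetric (base m p) Y (transl (base m p) (boundaryFrame p hp e i)) = 0 := by
    intro i
    refine Fin.cases ?_ (fun i => ?_) i
    · rw [f0, h1]
    · rw [fs, h2]
  have g2 : ∀ i j, fiberMetric (base m p) Y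
      (rotation (base m p) (boundaryFrame p hp e i) (boundaryFrame p hp e j)) = 0 := by
    intro i j
    refine Fin.cases ?_ (fun i => ?_) i <;> refine Fin.cases ?_ (fun j => ?_) j
    · rw [rotation_self, map_zero]
    · rw [f0, fs, h4]
    · rw [rotation_swap, map_neg, f0, fs, h4, neg_zero]
    · rw [fs, fs, h5]
  -- The pairings vanish on the frame, hence on all tangent vectors by linearity in `u` and
  -- bilinearity in `u, v`.
  refine eq_zero_of_fiberMetric (base m p) Y (fun u => ?_) fun u v => ?_
  · rw [← (boundaryFrame p hp e).sum_repr' u]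
    simp [g1]
  · rw [← (boundaryFrame p hp e).sum_repr' u, ← (boundaryFrame p hp e).sum_repr' v]
    have hr : ∀ a b, ⁅transl (base m p) a, transl (base m p) b⁆ = rotation (base m p) a b :=
      fun _ _ => rfl
    rw [← hr]
    simp only [map_sum, map_smul, sum_lie, lie_sum, smul_lie, lie_smul]
    simp only [hr, g2, smul_zero, Finset.sum_const_zero]

/-- The direction `w` is left general to cover both brackets in `Tω(n, e_s)`: `w = n` and `w = e_s`.
-/
lemma fiberMetric_lie_combination (Y : EFiber m p) (w : TangentAt m p) :
    fiberMetric (base m p) Y ⁅transl (base m p) w, 𝐜⁆ =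
      cN * fiberMetric (base m p) Y (rotation (base m p) w 𝐧)
      + ∑ i, cE i * fiberMetric (base m p) Y (rotation (base m p) w (e i))
      + ∑ q, cT q * (inner ℝ (e q.1.1 : TangentAt m p) w *
            fiberMetric (base m p) Y (transl (base m p) (e q.1.2))
          - inner ℝ (e q.1.2 : TangentAt m p) w *
            fiberMetric (base m p) Y (transl (base m p) (e q.1.1)))
      + ∑ i, cR i * (inner ℝ 𝐧 w * fiberMetric (base m p) Y (transl (base m p) (e i))
          - inner ℝ (e i : TangentAt m p) w *
            fiberMetric (base m p) Y (transl (base m p) 𝐧)) := by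
  simp only [combination, lie_add, lie_sum, lie_smul, lie_transl_rotation, map_add, map_sum,
    map_smul, map_sub, smul_eq_mul]
  rfl

end Frame

lemma skew_apply {m : ℕ} (D : Matrix (Pairs m) (Fin 1) ℝ) (i j : Fin m) :
    skew D i j = ∑ q : Pairs m, D q 0 *
      ((if q.1.1 = i ∧ q.1.2 = j then 1 else 0) - (if q.1.2 = i ∧ q.1.1 = j then 1 else 0)) := by
  simp [skew, Matrix.sum_apply, Matrix.single_apply]

/-! ### The blocks of `ω` and the pairing of `ω` with `Tω` -/

section

variable {m : ℕ} {W : Type*} [TopologicalSpace W] [ChartedSpace (HalfSpace m) W]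
  (p : W) (hp : p ∈ bdry m W) (e : OrthonormalBasis (Fin m) ℝ (bdryTangent m p))

/-- The pairing of `ω(e_s)` with `Tω(n, e_s)`, summed over `s`. -/
lemma sum_fiberMetric_opT (ω : EForm m W) (β : Blocks m)
    (h : IsBlockDecomposition ω p hp (fun i => (e i : TangentAt m p)) β) :
    ∑ s, fiberMetric (base m p) (ω.toForm p fun _ => (e s : TangentAt m p))
      (opT (base m p) (ω.toForm p) ![outwardNormal m p hp, (e s : TangentAt m p)]) =
      β.integrand := by
  -- The first two sums come from `[N, ω(e_s)]`. The subtracted bracket is `[E_s, ω(n)]`, with its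
  -- `F`, `E`, `D`, `C` parts in this order.
  have key : ∀ s, fiberMetric (base m p) (ω.toForm p fun _ => (e s : TangentAt m p))
      (opT (base m p) (ω.toForm p) ![outwardNormal m p hp, (e s : TangentAt m p)]) =
      (∑ i, β.A i s * β.B i s + ∑ i, β.B i s * β.A i s) - (-(β.F 0 0 * β.B s s)
        + ∑ i, β.E i 0 * ∑ q, β.H q s * rotCoeff q s i
        + ∑ q : Pairs m, β.D q 0 * ((if q.1.1 = s then 1 else 0) * β.A q.1.2 s
          - (if q.1.2 = s then 1 else 0) * β.A q.1.1 s)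
        + -(β.C s 0 * β.G 0 s)) := by
    intro s
    rw [opT_one_apply, h.1, h.2 s, map_sub, fiberMetric_lie_combination,
      fiberMetric_lie_combination, rotation_self, map_zero, mul_zero, zero_add,
      rotation_swap (base m p) (outwardNormal m p hp), map_neg]
    simp only [fiberMetric_combination_rotation_normal, fiberMetric_combination_transl,
      fiberMetric_combination_rotation, fiberMetric_combination_transl_normal,
      inner_outwardNormal_self, real_inner_comm (outwardNormal m p hp),
      inner_outwardNormal_bdryTangent, inner_coe_basis]
    simp
  -- The minus sign is that of `R_si = -R_is`: `rot` uses the opposite order of indices. It cancels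
  -- the minus sign in `Tω`, as does the one in `hD`.
  have hE : ∀ s, ∑ i, β.E i 0 * ∑ q, β.H q s * rotCoeff q s i =
      -∑ q, β.H q s * rot β.E q s := by
    intro s
    simp only [rot, Matrix.of_apply, Finset.mul_sum]
    rw [Finset.sum_comm, ← Finset.sum_neg_distrib]
    refine Finset.sum_congr rfl fun q _ => ?_
    rw [← Finset.sum_neg_distrib]
    refine Finset.sum_congr rfl fun i _ => ?_
    rw [rotCoeff_swap q s i]
    ring
  have hD : ∀ s, ∑ q : Pairs m, β.D q 0 * ((if q.1.1 = s then 1 else 0) * β.A q.1.2 s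
          - (if q.1.2 = s then 1 else 0) * β.A q.1.1 s) = -∑ i, β.A i s * skew β.D i s := by
    intro s
    simp only [skew_apply, Finset.mul_sum]
    rw [Finset.sum_comm, ← Finset.sum_neg_distrib]
    refine Finset.sum_congr rfl fun q _ => ?_
    simp only [ite_and, mul_sub, Finset.sum_sub_distrib]
    simp
    ring_nf
  simp only [key, hE, hD, Blocks.integrand, matDot, Finset.sum_add_distrib,
    Finset.sum_sub_distrib, Finset.sum_neg_distrib]
  -- `matDot` sums rows outermost, whereas the sum over `s` runs over columns.
  rw [Finset.sum_comm (f := fun i j => β.A i j * β.B i j),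
    Finset.sum_comm (f := fun i j => β.B i j * β.A i j),
    Finset.sum_comm (f := fun i j => β.A i j * skew β.D i j),
    Finset.sum_comm (f := fun i j => β.H i j * rot β.E i j)]
  have h1 : ∑ i, ∑ j, β.B i j * (β.F 0 0 • (1 : Matrix (Fin m) (Fin m) ℝ)) i j =
      ∑ s, β.F 0 0 * β.B s s := by
    simp [Matrix.one_apply, mul_comm]
  have h2 : ∑ i, ∑ j, β.G i j * β.Cᵀ i j = ∑ s, β.C s 0 * β.G 0 s := by
    simp [mul_comm]
  rw [h1, h2]
  ring

/-- Each block entry is forced to be the pairing of `ω(n)` or `ω(e_j)` with the matching element of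
the fibre's frame, and these pairings do reconstruct `ω`. -/
lemma existsUnique_blockDecomposition (ω : EForm m W) :
    ∃! β : Blocks m, IsBlockDecomposition ω p hp (fun i => (e i : TangentAt m p)) β := by
  set X := ω.toForm p fun _ => outwardNormal m p hp
  set Y : Fin m → EFiber m p := fun j => ω.toForm p fun _ => (e j : TangentAt m p)
  set μ := fiberMetric (base m p)
  set n := outwardNormal m p hp
  set x := base m p
  refine ⟨⟨fun i j => μ (Y j) (transl x (e i)), fun i j => μ (Y j) (rotation x n (e i)),
    fun i _ => μ X (rotation x n (e i)), fun q _ => μ X (rotation x (e q.1.1) (e q.1.2)),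
    fun i _ => μ X (transl x (e i)), fun _ _ => μ X (transl x n),
    fun _ j => μ (Y j) (transl x n), fun q j => μ (Y j) (rotation x (e q.1.1) (e q.1.2))⟩,
    ⟨eq_combination p hp e X, fun j => eq_combination p hp e (Y j)⟩, ?_⟩
  rintro ⟨A, B, C, D, E, F, G, H⟩ ⟨h1, h2⟩
  have h1' : X = _ := h1
  have h2' : ∀ j, Y j = _ := h2
  simp only at h1' h2'
  congr
  · funext i j
    rw [h2', fiberMetric_combination_transl]
  · funext i j
    rw [h2', fiberMetric_combination_rotation_normal]
  · funext i j
    rw [h1', fiberMetric_combination_rotation_normal, Subsingleton.elim j 0]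
  · funext i j
    rw [h1', fiberMetric_combination_rotation_pair, Subsingleton.elim j 0]
  · funext i j
    rw [h1', fiberMetric_combination_transl, Subsingleton.elim j 0]
  · funext i j
    rw [h1', fiberMetric_combination_transl_normal, Subsingleton.elim j 0, Subsingleton.elim i 0]
  · funext i j
    rw [h2', fiberMetric_combination_transl_normal, Subsingleton.elim i 0]
  · funext i j
    rw [h2', fiberMetric_combination_rotation_pair]

end

/-! ### Restriction of `α ∧ ⋆β` to the boundary -/

section

variable {l : ℕ} {W : Type*} [TopologicalSpace W] [ChartedSpace (HalfSpace (l + 1)) W]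
  (o : ManifoldOrientation (l + 1) W) (p : W) (hp : p ∈ bdry (l + 1) W)

/-- The Hodge star of a 2-form at a boundary point, on tangential vectors. -/
lemma hodgeStar_two_boundary {F : Type*} [AddCommGroup F] [Module ℝ F] (h : 2 + l = l + 2)
    (β : TangentAt (l + 1) p [⋀^Fin 2]→ₗ[ℝ] F)
    (e : OrthonormalBasis (Fin (l + 1)) ℝ (bdryTangent (l + 1) p)) :
    hodgeStar (o.orient p) h β (fun k : Fin l => (e k.succ : TangentAt (l + 1) p)) =
      volM o p hp e • β ![outwardNormal (l + 1) p hp, (e 0 : TangentAt (l + 1) p)] := by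
  -- The frame begins with `n`, so its volume unfolds to `volM` on `e`, and its last `l` vectors are
  -- `e` without `e 0`.
  have h1 := hodgeStar_two_apply (o.orient p) h β (boundaryFrame p hp e)
  rw [coe_boundaryFrame] at h1
  exact h1

/-- `α ∧ ⋆β`, restricted to the boundary, for a 1-form `α` and a 2-form `β`. -/
lemma wedge_hodgeStar_boundary {N₁ N₂ : Type*} [AddCommGroup N₁] [Module ℝ N₁]
    [AddCommGroup N₂] [Module ℝ N₂] (B : N₁ →ₗ[ℝ] N₂ →ₗ[ℝ] ℝ) (h : 2 + l = l + 2)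
    (h' : 1 + l = l + 1) (α : TangentAt (l + 1) p [⋀^Fin 1]→ₗ[ℝ] N₁)
    (β : TangentAt (l + 1) p [⋀^Fin 2]→ₗ[ℝ] N₂)
    (e : OrthonormalBasis (Fin (l + 1)) ℝ (bdryTangent (l + 1) p)) :
    wedge B h' α (hodgeStar (o.orient p) h β) (fun i => (e i : TangentAt (l + 1) p)) =
      (∑ s, B (α fun _ => (e s : TangentAt (l + 1) p))
        (β ![outwardNormal (l + 1) p hp, (e s : TangentAt (l + 1) p)])) * volM o p hp e := by
  set t : Fin (l + 1) → ℝ := fun s => B (α fun _ => (e s : TangentAt (l + 1) p))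
        (β ![outwardNormal (l + 1) p hp, (e s : TangentAt (l + 1) p)]) with ht
  have h1 := factorial_smul_wedge_one_apply B h' α (hodgeStar (o.orient p) h β)
    (fun i => (e i : TangentAt (l + 1) p))
  have h2 : ∀ σ : Equiv.Perm (Fin (l + 1)), Equiv.Perm.sign σ •
      B (α fun _ => (e (σ 0) : TangentAt (l + 1) p))
        (hodgeStar (o.orient p) h β fun j : Fin l => (e (σ j.succ) : TangentAt (l + 1) p)) =
      t (σ 0) * volM o p hp e := by
    intro σ
    -- `e.reindex σ.symm` is the basis `e ∘ σ`. Its volume contributes a second factor `sign σ`,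
    -- which cancels the first.
    have h3 := hodgeStar_two_boundary o p hp h β (e.reindex σ.symm)
    simp only [OrthonormalBasis.reindex_apply, Equiv.symm_symm] at h3
    have h4 : volM o p hp (e.reindex σ.symm) = Equiv.Perm.sign σ • volM o p hp e := by
      rw [← AlternatingMap.map_perm]
      congr 1
      funext i
      simp
    rw [h3, h4, map_smul, Units.smul_def, Units.smul_def, ht]
    simp only [zsmul_eq_mul, smul_eq_mul]
    have h5 : ((Equiv.Perm.sign σ : ℤ) : ℝ) * ((Equiv.Perm.sign σ : ℤ) : ℝ) = 1 := by
      rw [← Int.cast_mul, ← Units.val_mul, Int.units_mul_self]; simp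
    linear_combination (volM o p hp e * B (α fun _ => (e (σ 0) : TangentAt (l + 1) p))
        (β ![outwardNormal (l + 1) p hp, (e (σ 0) : TangentAt (l + 1) p)])) * h5
  -- Exactly `l!` permutations send `0` to a given `s`; this matches the factor `l!` in the formula
  -- for the wedge product.
  have h6 : ∑ σ : Equiv.Perm (Fin (l + 1)), t (σ 0) = l.factorial * ∑ s, t s := by
    rw [Fintype.sum_equiv Equiv.Perm.decomposeFin (fun σ => t (σ 0)) (fun x => t x.1)
      (fun σ => by
        rw [← Equiv.Perm.decomposeFin_symm_apply_zero (Equiv.Perm.decomposeFin σ).1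
          (Equiv.Perm.decomposeFin σ).2, Prod.mk.eta, Equiv.symm_apply_apply]),
      Fintype.sum_prod_type]
    simp [Fintype.card_perm, Finset.mul_sum]
  simp only [h2] at h1
  rw [← Finset.sum_mul, h6, nsmul_eq_mul, mul_assoc] at h1
  exact mul_left_cancel₀ (Nat.cast_ne_zero.mpr l.factorial_ne_zero) h1

end

end Hyp

theorem mainTheorem7 (m : ℕ) (hm : 1 ≤ m) {W : Type*} [TopologicalSpace W]
    [ChartedSpace (Hyp.HalfSpace m) W] [Hyp.IsHyperbolicManifold m W]
    (o : Hyp.ManifoldOrientation m W) (ω : Hyp.EForm m W)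
    (p : W) (hp : p ∈ Hyp.bdry m W)
    (e : OrthonormalBasis (Fin m) ℝ (Hyp.bdryTangent m p)) :
    (∃! β : Hyp.Blocks m,
      Hyp.IsBlockDecomposition ω p hp (fun i => (e i : Hyp.TangentAt m p)) β) ∧
    ∀ β : Hyp.Blocks m,
      Hyp.IsBlockDecomposition ω p hp (fun i => (e i : Hyp.TangentAt m p)) β →
      Hyp.restrictM (Hyp.wedgeStarT hm o ω p) = β.integrand • Hyp.volM o p hp := by
  refine ⟨Hyp.existsUnique_blockDecomposition p hp e ω, fun β hβ => ?_⟩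
  obtain ⟨l, rfl⟩ : ∃ l, m = l + 1 := ⟨m - 1, by omega⟩
  have key : Hyp.restrictM (Hyp.wedgeStarT hm o ω p) e =
      (β.integrand • Hyp.volM o p hp) e := by
    rw [AlternatingMap.smul_apply, smul_eq_mul, ← Hyp.sum_fiberMetric_opT p hp e ω β hβ]
    exact Hyp.wedge_hodgeStar_boundary o p hp (Hyp.fiberMetric (Hyp.base (l + 1) p)) (by omega)
      (by omega) (ω.toForm p) (Hyp.opT (Hyp.base (l + 1) p) (ω.toForm p)) e
  -- An alternating form is determined by its values on injective families of basis vectors. An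
  -- injective `v : Fin m → Fin m` is a permutation, and both sides change by its sign, so `key`
  -- suffices.
  refine e.toBasis.ext_alternating fun v hv => ?_
  simp only [OrthonormalBasis.coe_toBasis]
  have hσ := AlternatingMap.map_perm (Hyp.restrictM (Hyp.wedgeStarT hm o ω p)) e
    (Equiv.ofBijective v (Finite.injective_iff_bijective.mp hv))
  have hσ' := AlternatingMap.map_perm (β.integrand • Hyp.volM o p hp) e
    (Equiv.ofBijective v (Finite.injective_iff_bijective.mp hv))
  rw [key, ← hσ'] at hσ
  exact hσ
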